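/- Let $A\in\mathbb{R}^{m\times n}$, $b\in\mathbb{R}^m$, let $\|\cdot\|$ be the Euclidean norm and let $0<\varepsilon<\|b\|$. Golub–Kahan bidiagonalization of $A$ with starting vector $b$ computes $\sigma_1u_1=b$, $\rho_1v_1=A^Tu_1$ and, for $k\ge 1$, $$\sigma_{k+1}u_{k+1}=Av_k-\rho_ku_k,\qquad \rho_{k+1}v_{k+1}=A^Tu_{k+1}-\sigma_{k+1}v_k ,$$ where $\sigma_k,\rho_k\ge 0$ are the norms of the right-hand sides, $u_k,v_k$ are the normalized right-hand sides, and a right-hand side equal to $0$ gives the coefficient $0$ and the vector $0$ (so that the process is continued by zeros after it has terminated). Assume that there is no breakdown: $\rho_k,\sigma_k>0$ for all $1\le k\le\min\{m,n\}$. If $m>n$, assume moreover that $b=Ax+e$ for some $x\in\mathbb{R}^n$ and $e\in\mathbb{R}^m$ with $\|e\|<\varepsilon$. Let $B_k\in\mathbb{R}^{k\times k}$ be the lower bidiagonal matrix with diagonal $\rho_1,\dots,\rho_k$ and subdiagonal $\sigma_2,\dots,\sigma_k$, let $e_1$ be the first canonical basis vector of $\mathbb{R}^k$, and for $\beta>0$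 let $$\widehat f(\beta)=b^T(\beta AA^T+I)^{-2}b-\varepsilon^2,\qquad \mathcal G_k(\beta)=\|b\|^2e_1^T(\beta B_kB_k^T+I)^{-2}e_1-\varepsilon^2\quad(k\ge 1).$$ Then $\widehat f$ has exactly one root $\beta^\ast$ in $(0,+\infty)$. Let $\beta_1>0$ be such that $\mathcal G_1(\beta_1)\ge 0$, and let $$\beta_{k+1}=\beta_k-\frac{\mathcal G_k(\beta_k)}{\mathcal G_k'(\beta_k)},\qquad k\ge 1.$$ This recursion is well defined (for every $k\ge1$, $\beta_k>0$ and $\mathcal G_k$ is differentiable at $\beta_k$ with $\mathcal G_k'(\beta_k)\neq0$), and the sequence $(\beta_k)_{k\ge1}$ converges monotonically to $\beta^\ast$ from the left: $\beta_k\le\beta_{k+1}\le\beta^\ast$ for all $k\ge1$, and $\beta_k\to\beta^\ast$. -/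

import Mathlib

open Filter Topology Matrix

noncomputable section

/-- The data produced by one step of Golub–Kahan bidiagonalization. -/
structure GKBState (m n : ℕ) where
  /-- the left vector `u_k` -/
  u : EuclideanSpace ℝ (Fin m)
  /-- the right vector `v_k` -/
  v : EuclideanSpace ℝ (Fin n)
  /-- the diagonal entry `ρ_k` -/
  rho : ℝ
  /-- the subdiagonal entry `σ_k` (with `σ_1 = ‖b‖`) -/
  sigma : ℝ

/-- One step of the bidiagonalization: from a left residual `w` (which is `σ_k u_k`) and the
previous right vector `v_{k-1}`, normalize `w` to get `σ_k, u_k`, and then normalize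
`Aᵀ u_k - σ_k v_{k-1}` to get `ρ_k, v_k`. A residual which is zero is normalized to zero. -/
def gkbStep {m n : ℕ} (A : Matrix (Fin m) (Fin n) ℝ) (w : EuclideanSpace ℝ (Fin m))
    (vprev : EuclideanSpace ℝ (Fin n)) : GKBState m n :=
  let σ : ℝ := ‖w‖
  let u : EuclideanSpace ℝ (Fin m) := σ⁻¹ • w
  let z : EuclideanSpace ℝ (Fin n) := Matrix.toEuclideanLin Aᵀ u - σ • vprev
  let ρ : ℝ := ‖z‖
  ⟨u, ρ⁻¹ • z, ρ, σ⟩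

/-- Golub–Kahan bidiagonalization of `A` with starting vector `b`:
`gkb A b k` holds `u_{k+1}, v_{k+1}, ρ_{k+1}, σ_{k+1}`, where `σ_1 u_1 = b`, `ρ_1 v_1 = Aᵀ u_1`,
`σ_{k+1} u_{k+1} = A v_k - ρ_k u_k` and `ρ_{k+1} v_{k+1} = Aᵀ u_{k+1} - σ_{k+1} v_k`.
Once the process has terminated, it is continued by zeros. -/
def gkb {m n : ℕ} (A : Matrix (Fin m) (Fin n) ℝ) (b : EuclideanSpace ℝ (Fin m)) :
    ℕ → GKBState m n
  | 0 => gkbStep A b 0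
  | k + 1 =>
    gkbStep A (Matrix.toEuclideanLin A (gkb A b k).v - (gkb A b k).rho • (gkb A b k).u)
      (gkb A b k).v

/-- The bidiagonalization does not break down: `ρ_k, σ_k > 0` for `1 ≤ k ≤ min m n`. -/
def GKBNoBreakdown {m n : ℕ} (A : Matrix (Fin m) (Fin n) ℝ) (b : EuclideanSpace ℝ (Fin m)) :
    Prop :=
  ∀ k < min m n, 0 < (gkb A b k).rho ∧ 0 < (gkb A b k).sigma

/-- The `k × k` lower bidiagonal matrix `B_k`, with diagonal `ρ_1, …, ρ_k` and
subdiagonal `σ_2, …, σ_k`. -/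
def gkbMatrix {m n : ℕ} (A : Matrix (Fin m) (Fin n) ℝ) (b : EuclideanSpace ℝ (Fin m)) (k : ℕ) :
    Matrix (Fin k) (Fin k) ℝ :=
  Matrix.of fun i j =>
    if i = j then (gkb A b i).rho
    else if (i : ℕ) = (j : ℕ) + 1 then (gkb A b i).sigma
    else 0

/-- The first canonical basis vector of `ℝ^k` (for `k ≥ 1`). -/
def firstBasisVec (k : ℕ) : Fin k → ℝ := fun i => if (i : ℕ) = 0 then 1 else 0

/-- The discrepancy function `f̂(β) = bᵀ (β A Aᵀ + I)⁻² b - ε²`. -/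
def discrepancyFun {m n : ℕ} (A : Matrix (Fin m) (Fin n) ℝ) (b : EuclideanSpace ℝ (Fin m))
    (ε β : ℝ) : ℝ :=
  b.ofLp ⬝ᵥ (((β • (A * Aᵀ) + 1)⁻¹ ^ 2) *ᵥ b.ofLp) - ε ^ 2

/-- The Gauss quadrature approximation
`G_k(β) = ‖b‖² e₁ᵀ (β B_k B_kᵀ + I)⁻² e₁ - ε²` of the discrepancy function. -/
def gaussBound {m n : ℕ} (A : Matrix (Fin m) (Fin n) ℝ) (b : EuclideanSpace ℝ (Fin m))
    (ε : ℝ) (k : ℕ) (β : ℝ) : ℝ :=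
  ‖b‖ ^ 2 *
      (firstBasisVec k ⬝ᵥ
        (((β • (gkbMatrix A b k * (gkbMatrix A b k)ᵀ) + 1)⁻¹ ^ 2) *ᵥ firstBasisVec k))
    - ε ^ 2

end

/-!
The functions `G_k` increase with `k`, agree with the discrepancy function `f` for `k ≥ m`, and each
of them is convex and decreasing. A Newton step for `G_k` from a point where `G_k ≥ 0` therefore
moves right and ends at a point where `G_k ≥ 0`, hence `G_{k+1} ≥ 0` and `f ≥ 0`: the iterates
increase and stay left of the root of `f`. For `k ≥ m` they are Newton iterates for `f` itself, so
their limit is that root (`newton_monotone_family`).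

* Convexity and monotonicity: in an orthonormal eigenbasis, `cᵀ (β S + I)⁻² c` is a sum of terms
  `aᵢ / (1 + β λᵢ)²` with `aᵢ, λᵢ ≥ 0` (`dotProduct_resolvent_sq_eq_dampedSum`).
* `G_k ≤ G_{k+1}` needs no theory of Gauss quadrature. The matrix `β B_k B_kᵀ + I` is tridiagonal
  with nonnegative off-diagonal entries, and `G_k + ε²` is `‖b‖²` times the squared norm of the
  solution `x` of the system with right-hand side `e₁`. The factors of its `L D Lᵀ` factorization do
  not depend on `k`; forward and back substitution show that the entries of `x` alternate in sign
  and that their absolute values increase with `k` (`gaussBound_le_succ`).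
* `G_k = f` for `k ≥ m`: the vectors `u_i` are orthogonal, so they vanish from index `m + 1` on, and
  then `‖b‖ ∑ x_i u_i` solves `(β A Aᵀ + I) y = b` (`gaussBound_eq_discrepancyFun`).
* `f` becomes negative because `b` has distance less than `ε` to the range of `A`
  (`exists_discrepancyFun_neg`). For `m ≤ n` the absence of breakdown puts `b` into that range
  (`exists_toEuclideanLin_eq_of_noBreakdown`).
-/

/-! ### Sums of damped terms -/

/-- The function `β ↦ ∑ᵢ aᵢ / (1 + β λᵢ)²`. -/
noncomputable def dampedSum {ι : Type*} [Fintype ι] (a lam : ι → ℝ) (β : ℝ) : ℝ :=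
  ∑ i, a i / (1 + β * lam i) ^ 2

/-- The derivative of `dampedSum a lam` at `β ≥ 0`, when all `λᵢ ≥ 0`. -/
noncomputable def dampedSumDeriv {ι : Type*} [Fintype ι] (a lam : ι → ℝ) (β : ℝ) : ℝ :=
  ∑ i, -(2 * (a i * lam i) / (1 + β * lam i) ^ 3)

section DampedSum

variable {ι : Type*} [Fintype ι] {a lam : ι → ℝ}

theorem one_add_mul_pos_of_nonneg {x y : ℝ} (hx : 0 ≤ x) (hy : 0 ≤ y) : 0 < 1 + x * y := by
  positivity

theorem hasDerivAt_dampedSum (hl : ∀ i, 0 ≤ lam i) {x : ℝ} (hx : 0 ≤ x) :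
    HasDerivAt (dampedSum a lam) (dampedSumDeriv a lam x) x := by
  unfold dampedSum dampedSumDeriv
  refine HasDerivAt.fun_sum fun i _ => ?_
  have hp := one_add_mul_pos_of_nonneg hx (hl i)
  have h1 : HasDerivAt (fun y : ℝ => 1 + y * lam i) (lam i) x := by
    simpa using ((hasDerivAt_id x).mul_const (lam i)).const_add 1
  have h2 := (hasDerivAt_const x (a i)).div (h1.pow 2) (pow_ne_zero 2 hp.ne')
  refine h2.congr_deriv ?_
  have hp' := hp.ne'
  simp only [Pi.pow_apply]
  field_simp
  ring

theorem continuousOn_dampedSumDeriv (hl : ∀ i, 0 ≤ lam i) :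
    ContinuousOn (dampedSumDeriv a lam) (Set.Ioi 0) := by
  unfold dampedSumDeriv
  refine continuousOn_finsetSum _ fun i _ => ?_
  refine (ContinuousOn.div (by fun_prop) (by fun_prop) fun x hx => ?_).neg
  have := one_add_mul_pos_of_nonneg (le_of_lt hx) (hl i)
  positivity

theorem dampedSumDeriv_neg (ha : ∀ i, 0 ≤ a i) (hl : ∀ i, 0 ≤ lam i)
    (h : ∃ i, a i * lam i ≠ 0) {x : ℝ} (hx : 0 ≤ x) : dampedSumDeriv a lam x < 0 := by
  obtain ⟨j, hj⟩ := h
  unfold dampedSumDeriv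
  rw [Finset.sum_neg_distrib, neg_lt_zero]
  refine Finset.sum_pos' (fun i _ => ?_) ⟨j, Finset.mem_univ _, ?_⟩
  · have := one_add_mul_pos_of_nonneg hx (hl i)
    have := mul_nonneg (ha i) (hl i)
    positivity
  · have := one_add_mul_pos_of_nonneg hx (hl j)
    have := (mul_nonneg (ha j) (hl j)).lt_of_ne' hj
    positivity

/-- `dampedSum` is convex on the nonnegative reals: its graph lies above its tangents. -/
theorem dampedSum_tangent_le (ha : ∀ i, 0 ≤ a i) (hl : ∀ i, 0 ≤ lam i) {x y : ℝ}
    (hx : 0 ≤ x) (hy : 0 ≤ y) :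
    dampedSum a lam x + dampedSumDeriv a lam x * (y - x) ≤ dampedSum a lam y := by
  unfold dampedSum dampedSumDeriv
  rw [Finset.sum_mul, ← Finset.sum_add_distrib]
  refine Finset.sum_le_sum fun i _ => ?_
  have hs := one_add_mul_pos_of_nonneg hx (hl i)
  have ht := one_add_mul_pos_of_nonneg hy (hl i)
  have h : lam i * (y - x) = (1 + y * lam i) - (1 + x * lam i) := by ring
  have e : -(2 * (a i * lam i) / (1 + x * lam i) ^ 3) * (y - x) =
      -(2 * a i * (lam i * (y - x)) / (1 + x * lam i) ^ 3) := by ring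
  rw [e, h]
  generalize 1 + x * lam i = s at hs
  generalize 1 + y * lam i = t at ht
  have hi := ha i
  have key : a i / t ^ 2 - (a i / s ^ 2 + -(2 * a i * (t - s) / s ^ 3)) =
      a i * (t - s) ^ 2 * (2 * t + s) / (t ^ 2 * s ^ 3) := by
    field_simp
    ring
  rw [← sub_nonneg, key]
  positivity

theorem tendsto_dampedSum_atTop (hl : ∀ i, 0 ≤ lam i) :
    Tendsto (dampedSum a lam) atTop (𝓝 (∑ i, if lam i = 0 then a i else 0)) := by
  unfold dampedSum
  refine tendsto_finsetSum _ fun i _ => ?_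
  split_ifs with h
  · simp [h]
  · have hpos := (hl i).lt_of_ne' h
    refine Tendsto.const_div_atTop ?_ _
    refine (tendsto_pow_atTop two_ne_zero).comp ?_
    exact tendsto_atTop_add_const_left _ _ (tendsto_id.atTop_mul_const hpos)

end DampedSum

/-! ### Quadratic forms in the resolvent of a positive semidefinite matrix -/

theorem posDef_smul_add_one {ι : Type*} [DecidableEq ι] {S : Matrix ι ι ℝ} (hS : S.PosSemidef)
    {β : ℝ} (hβ : 0 ≤ β) : (β • S + 1).PosDef :=
  Matrix.PosDef.posSemidef_add (hS.smul hβ) Matrix.PosDef.one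

section Resolvent

variable {ι : Type*} [Fintype ι] {S : Matrix ι ι ℝ}

theorem inner_eq_ofLp_dotProduct (x y : EuclideanSpace ℝ ι) :
    inner ℝ x y = x.ofLp ⬝ᵥ y.ofLp := by
  rw [EuclideanSpace.inner_eq_star_dotProduct, dotProduct_comm]
  simp

theorem dotProduct_mulVec_of_isHermitian (hS : S.IsHermitian) (x y : ι → ℝ) :
    x ⬝ᵥ (S *ᵥ y) = (S *ᵥ x) ⬝ᵥ y := by
  rw [Matrix.dotProduct_mulVec, ← Matrix.mulVec_transpose]
  congr 2

variable [DecidableEq ι]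

theorem dotProduct_inv_sq_mulVec {M : Matrix ι ι ℝ} (hM : M.PosDef) {x c : ι → ℝ}
    (hx : M *ᵥ x = c) : c ⬝ᵥ ((M⁻¹ ^ 2) *ᵥ c) = x ⬝ᵥ x := by
  have hdet : IsUnit M.det := (Matrix.isUnit_iff_isUnit_det M).1 hM.isUnit
  have hinv : M⁻¹ *ᵥ c = x := by
    rw [← hx, Matrix.mulVec_mulVec, Matrix.nonsing_inv_mul _ hdet, Matrix.one_mulVec]
  have hsymm : (M⁻¹)ᵀ = M⁻¹ := by
    rw [Matrix.transpose_nonsing_inv]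
    congr 1
    simpa using hM.isHermitian.eq
  rw [pow_two, ← Matrix.mulVec_mulVec, hinv, Matrix.dotProduct_mulVec, ← Matrix.mulVec_transpose,
    hsymm, hinv]

theorem exists_mulVec_eq {M : Matrix ι ι ℝ} (hM : M.PosDef) (c : ι → ℝ) : ∃ x, M *ᵥ x = c := by
  have hdet : IsUnit M.det := (Matrix.isUnit_iff_isUnit_det M).1 hM.isUnit
  exact ⟨M⁻¹ *ᵥ c, by rw [Matrix.mulVec_mulVec, Matrix.mul_nonsing_inv _ hdet, Matrix.one_mulVec]⟩

/-- The squared coefficients of `c` in the orthonormal eigenbasis of the Hermitian matrix `S`. -/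
noncomputable def eigenWeight (hS : S.IsHermitian) (c : ι → ℝ) (i : ι) : ℝ :=
  ((hS.eigenvectorBasis i).ofLp ⬝ᵥ c) ^ 2

theorem dotProduct_self_eq_sum_eigenWeight (hS : S.IsHermitian) (c : ι → ℝ) :
    c ⬝ᵥ c = ∑ i, eigenWeight hS c i := by
  have h := hS.eigenvectorBasis.sum_sq_norm_inner_right (WithLp.toLp 2 c)
  rw [← real_inner_self_eq_norm_sq, inner_eq_ofLp_dotProduct] at h
  rw [← h]
  simp [eigenWeight, inner_eq_ofLp_dotProduct]

/-- The spectral form of the quadratic form `cᵀ (β S + I)⁻² c`. -/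
theorem dotProduct_resolvent_sq_eq_dampedSum (hS : S.PosSemidef) (c : ι → ℝ) {β : ℝ}
    (hβ : 0 ≤ β) :
    c ⬝ᵥ (((β • S + 1)⁻¹ ^ 2) *ᵥ c) =
      dampedSum (eigenWeight hS.isHermitian c) hS.isHermitian.eigenvalues β := by
  have hM := posDef_smul_add_one hS hβ
  obtain ⟨x, hx⟩ := exists_mulVec_eq hM c
  rw [dotProduct_inv_sq_mulVec hM hx, dotProduct_self_eq_sum_eigenWeight hS.isHermitian]
  refine Finset.sum_congr rfl fun i _ => ?_
  have hp := one_add_mul_pos_of_nonneg hβ (hS.eigenvalues_nonneg i)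
  have hc : (hS.isHermitian.eigenvectorBasis i).ofLp ⬝ᵥ c =
      (1 + β * hS.isHermitian.eigenvalues i) *
        ((hS.isHermitian.eigenvectorBasis i).ofLp ⬝ᵥ x) := by
    rw [← hx, dotProduct_mulVec_of_isHermitian hM.isHermitian, Matrix.add_mulVec,
      Matrix.smul_mulVec, hS.isHermitian.mulVec_eigenvectorBasis, Matrix.one_mulVec,
      add_dotProduct, smul_dotProduct, smul_dotProduct, smul_eq_mul, smul_eq_mul]
    ring
  unfold eigenWeight
  rw [hc, mul_pow, mul_div_cancel_left₀ _ (by positivity)]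

theorem eigenWeight_nonneg (hS : S.IsHermitian) (c : ι → ℝ) (i : ι) :
    0 ≤ eigenWeight hS c i := sq_nonneg _

/-- Some eigenvector with nonzero eigenvalue contributes to `c` unless `S c = 0`. -/
theorem exists_eigenWeight_mul_ne_zero (hS : S.IsHermitian) {c : ι → ℝ}
    (hc : S *ᵥ c ≠ 0) : ∃ i, eigenWeight hS c i * hS.eigenvalues i ≠ 0 := by
  by_contra! h
  apply hc
  rw [← dotProduct_self_eq_zero, dotProduct_self_eq_sum_eigenWeight hS]
  refine Finset.sum_eq_zero fun i _ => ?_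
  have : eigenWeight hS (S *ᵥ c) i = eigenWeight hS c i * hS.eigenvalues i ^ 2 := by
    unfold eigenWeight
    rw [dotProduct_mulVec_of_isHermitian hS, hS.mulVec_eigenvectorBasis, smul_dotProduct,
      smul_eq_mul]
    ring
  rw [this, pow_two, ← mul_assoc, h i, zero_mul]

end Resolvent

/-! ### Newton's method for a monotone family of convex decreasing functions -/

/-- Newton's method, started at a point where `G 1` is nonnegative and applied in its `k`-th step
to `G k`. Each `G k` is decreasing and lies above its tangents, so a step keeps `G k` nonnegative
and moves right; as `G k ≤ G (k + 1)`, this carries over to the next step. Since the functions are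
eventually equal to one function, the limit is a fixed point of the Newton map of that function. -/
theorem newton_monotone_family {G G' : ℕ → ℝ → ℝ} {f : ℝ → ℝ} {K : ℕ} {β : ℕ → ℝ}
    (hderiv : ∀ k, 1 ≤ k → ∀ x, 0 < x → HasDerivAt (G k) (G' k x) x)
    (hneg : ∀ k, 1 ≤ k → ∀ x, 0 < x → G' k x < 0)
    (htan : ∀ k, 1 ≤ k → ∀ x y, 0 < x → 0 < y → G k x + G' k x * (y - x) ≤ G k y)
    (hcont : ∀ k, 1 ≤ k → ContinuousOn (G' k) (Set.Ioi 0))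
    (hmono : ∀ k, 1 ≤ k → ∀ x, 0 < x → G k x ≤ G (k + 1) x)
    (hK : 1 ≤ K) (hstab : ∀ k, K ≤ k → ∀ x, 0 < x → G k x = f x)
    (hroot : ∃ x, 0 < x ∧ f x < 0)
    (hβ : 0 < β 1) (hG : 0 ≤ G 1 (β 1))
    (hrec : ∀ k, 1 ≤ k → β (k + 1) = β k - G k (β k) / deriv (G k) (β k)) :
    (∀ k, 1 ≤ k → 0 < β k ∧ DifferentiableAt ℝ (G k) (β k) ∧ deriv (G k) (β k) ≠ 0) ∧
    ∃ βstar : ℝ, 0 < βstar ∧ f βstar = 0 ∧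
      (∀ x : ℝ, 0 < x → f x = 0 → x = βstar) ∧
      (∀ k : ℕ, 1 ≤ k → β k ≤ β (k + 1)) ∧
      (∀ k : ℕ, 1 ≤ k → β k ≤ βstar) ∧
      Tendsto β atTop (𝓝 βstar) := by
  have step : ∀ k, 1 ≤ k → 0 < β k → 0 ≤ G k (β k) →
      β k ≤ β (k + 1) ∧ 0 ≤ G (k + 1) (β (k + 1)) := by
    intro k hk hpos hnn
    have hd := hneg k hk _ hpos
    have hr := hrec k hk
    rw [(hderiv k hk _ hpos).deriv] at hr
    have hle : β k ≤ β (k + 1) := by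
      have := div_nonpos_of_nonneg_of_nonpos hnn hd.le
      linarith
    have hpos' := hpos.trans_le hle
    refine ⟨hle, le_trans ?_ (hmono k hk _ hpos')⟩
    have ht := htan k hk _ _ hpos hpos'
    have : G' k (β k) * (β (k + 1) - β k) = -G k (β k) := by
      rw [hr]
      field_simp [hd.ne]
      ring
    linarith
  have inv : ∀ k, 1 ≤ k → 0 < β k ∧ 0 ≤ G k (β k) := by
    intro k hk
    induction k, hk using Nat.le_induction with
    | base => exact ⟨hβ, hG⟩
    | succ k hk ih =>
      obtain ⟨h1, h2⟩ := step k hk ih.1 ih.2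
      exact ⟨ih.1.trans_le h1, h2⟩
  have hinc : ∀ k, 1 ≤ k → β k ≤ β (k + 1) := fun k hk => (step k hk (inv k hk).1 (inv k hk).2).1
  have hlef : ∀ k, 1 ≤ k → ∀ x, 0 < x → G k x ≤ f x := by
    intro k hk x hx
    have hup : ∀ j, G k x ≤ G (k + j) x := by
      intro j
      induction j with
      | zero => exact le_rfl
      | succ j ih => exact ih.trans (hmono (k + j) (by omega) x hx)
    rw [← hstab (k + K) (by omega) x hx]
    exact hup K
  have hanti : ∀ x y, 0 < x → x < y → f y < f x := by
    intro x y hx hxy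
    have hy := hx.trans hxy
    have ht := htan K hK y x hy hx
    have hd := hneg K hK y hy
    rw [hstab K le_rfl x hx, hstab K le_rfl y hy] at ht
    nlinarith
  have hfd : ∀ x, 0 < x → HasDerivAt f (G' K x) x := by
    intro x hx
    refine (hderiv K hK x hx).congr_of_eventuallyEq ?_
    filter_upwards [lt_mem_nhds hx] with y hy using (hstab K le_rfl y hy).symm
  have hfβ : ∀ k, 1 ≤ k → 0 ≤ f (β k) := fun k hk =>
    (inv k hk).2.trans (hlef k hk _ (inv k hk).1)
  have hder : ∀ k, K ≤ k → ∀ x, 0 < x → deriv (G k) x = G' K x := by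
    intro k hk x hx
    rw [← (hfd x hx).deriv]
    apply Filter.EventuallyEq.deriv_eq
    filter_upwards [lt_mem_nhds hx] with y hy using hstab k hk y hy
  obtain ⟨R, hR, hfR⟩ := hroot
  have hbound : ∀ k, 1 ≤ k → ∀ x, 0 < x → f x ≤ 0 → β k ≤ x := by
    intro k hk x hx hfx
    by_contra! h
    have := hanti x (β k) hx h
    linarith [hfβ k hk]
  -- The limit of the iterates; the shift makes the sequence start at index one.
  have hmonoβ : Monotone fun k => β (k + 1) :=
    monotone_nat_of_le_succ fun k => hinc (k + 1) (by omega)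
  have hbdd : BddAbove (Set.range fun k => β (k + 1)) :=
    ⟨R, by rintro _ ⟨k, rfl⟩; exact hbound (k + 1) (by omega) R hR hfR.le⟩
  have hlim' := tendsto_atTop_ciSup hmonoβ hbdd
  set L := ⨆ k, β (k + 1) with hL
  have hlim : Tendsto β atTop (𝓝 L) := (tendsto_add_atTop_iff_nat 1).1 hlim'
  have hβL : ∀ k, 1 ≤ k → β k ≤ L := by
    intro k hk
    obtain ⟨j, rfl⟩ : ∃ j, k = j + 1 := ⟨k - 1, by omega⟩
    exact le_ciSup hbdd j
  have hLpos : 0 < L := hβ.trans_le (hβL 1 le_rfl)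
  have hfL : f L = 0 := by
    have h1 : Tendsto (fun k => (β k - β (k + 1)) * G' K (β k)) atTop (𝓝 ((L - L) * G' K L)) :=
      (hlim.sub hlim').mul
        ((((hcont K hK).continuousAt (Ioi_mem_nhds hLpos)).tendsto).comp hlim)
    have h2 : Tendsto (fun k => f (β k)) atTop (𝓝 (f L)) :=
      ((hfd L hLpos).continuousAt.tendsto).comp hlim
    have h3 : (fun k => (β k - β (k + 1)) * G' K (β k)) =ᶠ[atTop] fun k => f (β k) := by
      filter_upwards [eventually_ge_atTop K] with k hk
      have hp := (inv k (hK.trans hk)).1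
      rw [hrec k (hK.trans hk), hder k hk _ hp, hstab k hk _ hp]
      have := (hneg K hK _ hp).ne
      field_simp
      ring
    have := tendsto_nhds_unique (h1.congr' h3) h2
    rw [← this]
    ring
  refine ⟨fun k hk => ?_, L, hLpos, hfL, fun x hx hfx => ?_, hinc, hβL, hlim⟩
  · have hp := (inv k hk).1
    refine ⟨hp, (hderiv k hk _ hp).differentiableAt, ?_⟩
    rw [(hderiv k hk _ hp).deriv]
    exact (hneg k hk _ hp).ne
  · rcases lt_trichotomy x L with h | h | h
    · have := hanti x L hx h
      linarith
    · exact h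
    · have := hanti L x hLpos h
      linarith

/-! ### The tridiagonal system with right-hand side the first basis vector -/

/-- The product of the upper bidiagonal matrix with diagonal `ρ` and superdiagonal
`σ₁, σ₂, …` with the sequence `s`. -/
def upperBidiag (ρ σ s : ℕ → ℝ) (j : ℕ) : ℝ := ρ j * s j + σ (j + 1) * s (j + 1)

/-- The product of the lower bidiagonal matrix with diagonal `ρ` and subdiagonal
`σ₁, σ₂, …` with the sequence `t`. -/
def lowerBidiag (ρ σ t : ℕ → ℝ) : ℕ → ℝ
  | 0 => ρ 0 * t 0
  | i + 1 => ρ (i + 1) * t (i + 1) + σ (i + 1) * t i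

/-- The pivots of the `L D Lᵀ` factorization of `β B Bᵀ + I`, where `B` is lower bidiagonal. -/
noncomputable def ldlPivot (ρ σ : ℕ → ℝ) (β : ℝ) : ℕ → ℝ
  | 0 => 1 + β * ρ 0 ^ 2
  | i + 1 => 1 + β * (ρ (i + 1) ^ 2 + σ (i + 1) ^ 2) -
      (β * σ (i + 1) * ρ i) ^ 2 / ldlPivot ρ σ β i

/-- The subdiagonal entry of the unit factor `L` of `β B Bᵀ + I` in row `i + 1`. -/
noncomputable def ldlRatio (ρ σ : ℕ → ℝ) (β : ℝ) (i : ℕ) : ℝ :=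
  β * σ (i + 1) * ρ i / ldlPivot ρ σ β i

/-- The absolute values of the solution of the forward substitution `L y = e₁`. -/
noncomputable def forwardAbs (ρ σ : ℕ → ℝ) (β : ℝ) : ℕ → ℝ
  | 0 => 1
  | i + 1 => ldlRatio ρ σ β i * forwardAbs ρ σ β i

/-- `backwardAbs ρ σ β j i` is the absolute value of entry `i` of the solution of
`(β B Bᵀ + I) x = e₁` of size `i + j`, obtained by `j` steps of back substitution. -/
noncomputable def backwardAbs (ρ σ : ℕ → ℝ) (β : ℝ) : ℕ → ℕ → ℝ
  | 0, _ => 0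
  | j + 1, i => forwardAbs ρ σ β i / ldlPivot ρ σ β i +
      ldlRatio ρ σ β i * backwardAbs ρ σ β j (i + 1)

/-- The solution of the system `(β B Bᵀ + I) x = e₁` of size `k`, extended by zeros. The signs
alternate because the off-diagonal entries of `β B Bᵀ + I` are nonnegative. -/
noncomputable def tridiagSol (ρ σ : ℕ → ℝ) (β : ℝ) (k i : ℕ) : ℝ :=
  (-1) ^ i * backwardAbs ρ σ β (k - i) i

section Tridiagonal

variable {ρ σ : ℕ → ℝ} {β : ℝ}

theorem one_add_le_ldlPivot (hβ : 0 ≤ β) (i : ℕ) : 1 + β * ρ i ^ 2 ≤ ldlPivot ρ σ β i := by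
  induction i with
  | zero => exact le_rfl
  | succ i ih =>
    have hpos : 0 < ldlPivot ρ σ β i := lt_of_lt_of_le (by positivity) ih
    have h1 : (β * σ (i + 1) * ρ i) ^ 2 / ldlPivot ρ σ β i ≤ β * σ (i + 1) ^ 2 := by
      rw [div_le_iff₀ hpos]
      calc (β * σ (i + 1) * ρ i) ^ 2 = β * σ (i + 1) ^ 2 * (β * ρ i ^ 2) := by ring
        _ ≤ β * σ (i + 1) ^ 2 * ldlPivot ρ σ β i := by
          gcongr
          linarith
    rw [ldlPivot]
    linarith

theorem ldlPivot_pos (hβ : 0 ≤ β) (i : ℕ) : 0 < ldlPivot ρ σ β i :=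
  lt_of_lt_of_le (by positivity) (one_add_le_ldlPivot hβ i)

theorem ldlRatio_nonneg (hρ : ∀ i, 0 ≤ ρ i) (hσ : ∀ i, 0 ≤ σ i) (hβ : 0 ≤ β) (i : ℕ) :
    0 ≤ ldlRatio ρ σ β i :=
  div_nonneg (mul_nonneg (mul_nonneg hβ (hσ _)) (hρ _)) (ldlPivot_pos hβ i).le

theorem forwardAbs_nonneg (hρ : ∀ i, 0 ≤ ρ i) (hσ : ∀ i, 0 ≤ σ i) (hβ : 0 ≤ β) (i : ℕ) :
    0 ≤ forwardAbs ρ σ β i := by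
  induction i with
  | zero => exact zero_le_one
  | succ i ih => exact mul_nonneg (ldlRatio_nonneg hρ hσ hβ i) ih

theorem backwardAbs_nonneg (hρ : ∀ i, 0 ≤ ρ i) (hσ : ∀ i, 0 ≤ σ i) (hβ : 0 ≤ β) (j i : ℕ) :
    0 ≤ backwardAbs ρ σ β j i := by
  induction j generalizing i with
  | zero => exact le_rfl
  | succ j ih =>
    exact add_nonneg (div_nonneg (forwardAbs_nonneg hρ hσ hβ i) (ldlPivot_pos hβ i).le)
      (mul_nonneg (ldlRatio_nonneg hρ hσ hβ i) (ih _))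

theorem backwardAbs_le_succ (hρ : ∀ i, 0 ≤ ρ i) (hσ : ∀ i, 0 ≤ σ i) (hβ : 0 ≤ β) (j i : ℕ) :
    backwardAbs ρ σ β j i ≤ backwardAbs ρ σ β (j + 1) i := by
  induction j generalizing i with
  | zero => exact backwardAbs_nonneg hρ hσ hβ 1 i
  | succ j ih =>
    have := mul_le_mul_of_nonneg_left (ih (i + 1)) (ldlRatio_nonneg hρ hσ hβ i)
    exact add_le_add_right this _

theorem backwardAbs_eq_zero {i : ℕ} (h : ∀ j, i ≤ j → σ (j + 1) = 0) (l : ℕ) {j : ℕ} (hj : i < j) :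
    backwardAbs ρ σ β l j = 0 := by
  have hf : ∀ j, i < j → forwardAbs ρ σ β j = 0 := by
    intro j hj
    obtain ⟨j, rfl⟩ : ∃ j', j = j' + 1 := ⟨j - 1, by omega⟩
    simp [forwardAbs, ldlRatio, h j (by omega)]
  induction l generalizing j with
  | zero => rfl
  | succ l ih => simp [backwardAbs, hf j hj, ih (show i < j + 1 by omega)]

theorem tridiagSol_self (k : ℕ) : tridiagSol ρ σ β k k = 0 := by
  simp [tridiagSol, backwardAbs]

theorem tridiagSol_sq (k i : ℕ) :
    tridiagSol ρ σ β k i ^ 2 = backwardAbs ρ σ β (k - i) i ^ 2 := by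
  rw [tridiagSol, mul_pow, ← pow_mul, mul_comm i 2, pow_mul]
  simp

theorem backwardAbs_step (hβ : 0 ≤ β) {k i : ℕ} (hi : i < k) :
    ldlPivot ρ σ β i * backwardAbs ρ σ β (k - i) i -
      β * σ (i + 1) * ρ i * backwardAbs ρ σ β (k - (i + 1)) (i + 1) = forwardAbs ρ σ β i := by
  have hne := (ldlPivot_pos (ρ := ρ) (σ := σ) hβ i).ne'
  rw [show k - i = (k - (i + 1)) + 1 by omega, backwardAbs, ldlRatio]
  field_simp
  ring

/-- `tridiagSol` solves the system `(I + β B Bᵀ) s = e₁`. -/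
theorem tridiagSol_spec (hβ : 0 ≤ β) {k i : ℕ} (hi : i < k) :
    tridiagSol ρ σ β k i + β * lowerBidiag ρ σ (upperBidiag ρ σ (tridiagSol ρ σ β k)) i =
      if i = 0 then 1 else 0 := by
  have h := backwardAbs_step (ρ := ρ) (σ := σ) hβ hi
  cases i with
  | zero =>
    simp only [lowerBidiag, upperBidiag, tridiagSol, ldlPivot, forwardAbs] at h ⊢
    rw [if_pos trivial]
    linear_combination h
  | succ i =>
    have h' := backwardAbs_step (ρ := ρ) (σ := σ) hβ (show i < k by omega)
    have hne := (ldlPivot_pos (ρ := ρ) (σ := σ) hβ i).ne'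
    have e1 : ldlPivot ρ σ β (i + 1) = 1 + β * (ρ (i + 1) ^ 2 + σ (i + 1) ^ 2) -
        β * σ (i + 1) * ρ i * ldlRatio ρ σ β i := by
      rw [ldlPivot, ldlRatio]
      ring
    have e2 : β * σ (i + 1) * ρ i = ldlRatio ρ σ β i * ldlPivot ρ σ β i := by
      rw [ldlRatio, div_mul_cancel₀ _ hne]
    simp only [lowerBidiag, upperBidiag, tridiagSol, forwardAbs] at h ⊢
    rw [e1] at h
    rw [if_neg (Nat.succ_ne_zero i)]
    linear_combination (-1) ^ (i + 1) * h - (-1) ^ (i + 1) * ldlRatio ρ σ β i * h' -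
      (-1) ^ (i + 1) * backwardAbs ρ σ β (k - i) i * e2

end Tridiagonal

/-! ### The Gauss quadrature approximations in terms of the tridiagonal solution -/

section GaussBound

variable {m n : ℕ} (A : Matrix (Fin m) (Fin n) ℝ) (b : EuclideanSpace ℝ (Fin m))

/-- The diagonal entries `ρ` of the bidiagonalization, indexed from `0`. -/
noncomputable def gkbRho (i : ℕ) : ℝ := (gkb A b i).rho

/-- The subdiagonal entries `σ` of the bidiagonalization, indexed from `0`. -/
noncomputable def gkbSigma (i : ℕ) : ℝ := (gkb A b i).sigma

theorem gkbMatrix_transpose_mulVec {k : ℕ} {s : ℕ → ℝ} (hs : s k = 0) :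
    (gkbMatrix A b k)ᵀ *ᵥ (fun i : Fin k => s i) =
      fun j : Fin k => upperBidiag (gkbRho A b) (gkbSigma A b) s j := by
  ext j
  have hj := j.2
  simp only [Matrix.mulVec, dotProduct, Matrix.transpose_apply, gkbMatrix, Matrix.of_apply,
    Fin.ext_iff]
  rw [Fin.sum_univ_eq_sum_range (fun i : ℕ => (if i = (j : ℕ) then (gkb A b i).rho else
    if i = (j : ℕ) + 1 then (gkb A b i).sigma else 0) * s i) k]
  have : ∀ i ∈ Finset.range k, (if i = (j : ℕ) then (gkb A b i).rho else
      if i = (j : ℕ) + 1 then (gkb A b i).sigma else 0) * s i =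
      (if i = (j : ℕ) then (gkb A b i).rho * s i else 0) +
      (if i = (j : ℕ) + 1 then (gkb A b i).sigma * s i else 0) := by
    intro i _
    split_ifs <;> first | omega | simp
  rw [Finset.sum_congr rfl this, Finset.sum_add_distrib, Finset.sum_ite_eq', Finset.sum_ite_eq']
  simp only [Finset.mem_range, hj, if_true, upperBidiag, gkbRho, gkbSigma]
  split_ifs with h
  · rfl
  · rw [show (j : ℕ) + 1 = k by omega, hs, mul_zero]

theorem gkbMatrix_mulVec {k : ℕ} (t : ℕ → ℝ) :
    gkbMatrix A b k *ᵥ (fun i : Fin k => t i) =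
      fun i : Fin k => lowerBidiag (gkbRho A b) (gkbSigma A b) t i := by
  ext i
  obtain ⟨i, hi⟩ := i
  simp only [Matrix.mulVec, dotProduct, gkbMatrix, Matrix.of_apply, Fin.ext_iff]
  rw [Fin.sum_univ_eq_sum_range (fun j : ℕ => (if i = j then (gkb A b i).rho else
    if i = j + 1 then (gkb A b i).sigma else 0) * t j) k]
  have : ∀ j ∈ Finset.range k, (if i = j then (gkb A b i).rho else
      if i = j + 1 then (gkb A b i).sigma else 0) * t j =
      (if i = j then (gkb A b i).rho * t j else 0) +
      (if i = j + 1 then (gkb A b i).sigma * t j else 0) := by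
    intro j _
    split_ifs <;> first | omega | simp
  rw [Finset.sum_congr rfl this, Finset.sum_add_distrib, Finset.sum_ite_eq]
  cases i with
  | zero => simp [lowerBidiag, gkbRho, hi]
  | succ i =>
    simp only [Nat.add_right_cancel_iff]
    rw [Finset.sum_ite_eq]
    simp [lowerBidiag, gkbRho, gkbSigma, hi, show i < k by omega]

theorem posSemidef_self_mul_transpose {ι κ : Type*} [Fintype κ] [Finite ι] (B : Matrix ι κ ℝ) :
    (B * Bᵀ).PosSemidef := by
  simpa using Matrix.posSemidef_self_mul_conjTranspose B

theorem gaussBound_eq_sum (ε : ℝ) (k : ℕ) {β : ℝ} (hβ : 0 ≤ β) :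
    gaussBound A b ε k β = ‖b‖ ^ 2 * (∑ i ∈ Finset.range k,
      backwardAbs (gkbRho A b) (gkbSigma A b) β (k - i) i ^ 2) - ε ^ 2 := by
  set s := tridiagSol (gkbRho A b) (gkbSigma A b) β k with hs
  have hsol : (β • (gkbMatrix A b k * (gkbMatrix A b k)ᵀ) + 1) *ᵥ (fun i : Fin k => s i) =
      firstBasisVec k := by
    rw [Matrix.add_mulVec, Matrix.smul_mulVec, Matrix.one_mulVec, ← Matrix.mulVec_mulVec,
      gkbMatrix_transpose_mulVec A b (tridiagSol_self k), gkbMatrix_mulVec]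
    ext i
    rw [firstBasisVec, ← tridiagSol_spec (ρ := gkbRho A b) (σ := gkbSigma A b) hβ i.2]
    simp [hs, add_comm]
  have hM := posDef_smul_add_one (posSemidef_self_mul_transpose (gkbMatrix A b k)) hβ
  rw [gaussBound, dotProduct_inv_sq_mulVec hM hsol, dotProduct,
    Fin.sum_univ_eq_sum_range (fun i => s i * s i)]
  congr 2
  refine Finset.sum_congr rfl fun i _ => ?_
  rw [← pow_two, hs, tridiagSol_sq]

/-- The approximations increase with `k`: the entries of the tridiagonal solution do so in
absolute value. -/
theorem gaussBound_le_succ (hρ : ∀ i, 0 ≤ gkbRho A b i) (hσ : ∀ i, 0 ≤ gkbSigma A b i) (ε : ℝ)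
    (k : ℕ) {β : ℝ} (hβ : 0 ≤ β) : gaussBound A b ε k β ≤ gaussBound A b ε (k + 1) β := by
  rw [gaussBound_eq_sum A b ε k hβ, gaussBound_eq_sum A b ε (k + 1) hβ, Finset.sum_range_succ]
  have : ∑ i ∈ Finset.range k, backwardAbs (gkbRho A b) (gkbSigma A b) β (k - i) i ^ 2 ≤
      ∑ i ∈ Finset.range k, backwardAbs (gkbRho A b) (gkbSigma A b) β (k + 1 - i) i ^ 2 := by
    refine Finset.sum_le_sum fun i hi => ?_
    have hi := Finset.mem_range.1 hi
    rw [show k + 1 - i = (k - i) + 1 by omega]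
    exact pow_le_pow_left₀ (backwardAbs_nonneg hρ hσ hβ _ _) (backwardAbs_le_succ hρ hσ hβ _ _) 2
  gcongr
  exact le_add_of_le_of_nonneg this (sq_nonneg _)

/-- `B_k B_kᵀ e₁` has first entry `ρ₁²`. -/
theorem gkbMatrix_mul_transpose_mulVec_ne_zero {k : ℕ} (hk : 1 ≤ k) (h : gkbRho A b 0 ≠ 0) :
    (gkbMatrix A b k * (gkbMatrix A b k)ᵀ) *ᵥ firstBasisVec k ≠ 0 := by
  intro h0
  have h1 := congrFun h0 ⟨0, hk⟩
  have h2 := gkbMatrix_transpose_mulVec A b (k := k) (s := fun i : ℕ => if i = 0 then 1 else 0)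
    (if_neg (by omega))
  change (gkbMatrix A b k)ᵀ *ᵥ firstBasisVec k = _ at h2
  rw [← Matrix.mulVec_mulVec, h2, gkbMatrix_mulVec] at h1
  simp [lowerBidiag, upperBidiag] at h1
  exact h h1

end GaussBound

/-! ### Golub–Kahan bidiagonalization -/

section GolubKahan

variable {m n : ℕ} (A : Matrix (Fin m) (Fin n) ℝ) (b : EuclideanSpace ℝ (Fin m))

theorem inner_toEuclideanLin (x : EuclideanSpace ℝ (Fin n)) (y : EuclideanSpace ℝ (Fin m)) :
    inner ℝ (Matrix.toEuclideanLin A x) y = inner ℝ x (Matrix.toEuclideanLin Aᵀ y) := by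
  rw [inner_eq_ofLp_dotProduct, inner_eq_ofLp_dotProduct, Matrix.ofLp_toLpLin, Matrix.ofLp_toLpLin,
    Matrix.toLin'_apply, Matrix.toLin'_apply, Matrix.dotProduct_mulVec, Matrix.vecMul_transpose]

theorem norm_smul_inv_norm_smul {E : Type*} [NormedAddCommGroup E] [NormedSpace ℝ E] (w : E) :
    ‖w‖ • ‖w‖⁻¹ • w = w := by
  by_cases h : w = 0
  · simp [h]
  · rw [smul_inv_smul₀ (norm_ne_zero_iff.2 h)]

theorem norm_inv_norm_smul {E : Type*} [NormedAddCommGroup E] [NormedSpace ℝ E] {w : E}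
    (h : ‖w‖ ≠ 0) : ‖‖w‖⁻¹ • w‖ = 1 := by
  rw [norm_smul, norm_inv, norm_norm, inv_mul_cancel₀ h]

theorem gkbStep_sigma_smul (w : EuclideanSpace ℝ (Fin m)) (v : EuclideanSpace ℝ (Fin n)) :
    (gkbStep A w v).sigma • (gkbStep A w v).u = w := norm_smul_inv_norm_smul w

theorem gkbStep_rho_smul (w : EuclideanSpace ℝ (Fin m)) (v : EuclideanSpace ℝ (Fin n)) :
    (gkbStep A w v).rho • (gkbStep A w v).v =
      Matrix.toEuclideanLin Aᵀ (gkbStep A w v).u - (gkbStep A w v).sigma • v :=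
  norm_smul_inv_norm_smul _

theorem exists_gkb_eq_gkbStep (k : ℕ) : ∃ w v, gkb A b k = gkbStep A w v := by
  cases k with
  | zero => exact ⟨_, _, rfl⟩
  | succ k => exact ⟨_, _, rfl⟩

theorem gkbRho_nonneg (k : ℕ) : 0 ≤ gkbRho A b k := by
  obtain ⟨w, v, h⟩ := exists_gkb_eq_gkbStep A b k
  rw [gkbRho, h]
  exact norm_nonneg _

theorem gkbSigma_nonneg (k : ℕ) : 0 ≤ gkbSigma A b k := by
  obtain ⟨w, v, h⟩ := exists_gkb_eq_gkbStep A b k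
  rw [gkbSigma, h]
  exact norm_nonneg _

theorem norm_gkb_u (k : ℕ) (hk : gkbSigma A b k ≠ 0) : ‖(gkb A b k).u‖ = 1 := by
  obtain ⟨w, v, h⟩ := exists_gkb_eq_gkbStep A b k
  rw [gkbSigma, h] at hk
  rw [h]
  exact norm_inv_norm_smul hk

theorem norm_gkb_v (k : ℕ) (hk : gkbRho A b k ≠ 0) : ‖(gkb A b k).v‖ = 1 := by
  obtain ⟨w, v, h⟩ := exists_gkb_eq_gkbStep A b k
  rw [gkbRho, h] at hk
  rw [h]
  exact norm_inv_norm_smul hk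

theorem gkb_u_eq_zero_iff (k : ℕ) : (gkb A b k).u = 0 ↔ gkbSigma A b k = 0 := by
  refine ⟨fun h => ?_, fun hk => ?_⟩
  · by_contra hk
    simpa [h] using norm_gkb_u A b k hk
  · obtain ⟨w, v, h⟩ := exists_gkb_eq_gkbStep A b k
    rw [gkbSigma, h] at hk
    rw [h]
    simp only [gkbStep] at hk ⊢
    simp [hk]

theorem gkb_v_eq_zero_iff (k : ℕ) : (gkb A b k).v = 0 ↔ gkbRho A b k = 0 := by
  refine ⟨fun h => ?_, fun hk => ?_⟩
  · by_contra hk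
    simpa [h] using norm_gkb_v A b k hk
  · obtain ⟨w, v, h⟩ := exists_gkb_eq_gkbStep A b k
    rw [gkbRho, h] at hk
    rw [h]
    simp only [gkbStep] at hk ⊢
    rw [hk]
    simp

theorem norm_smul_gkb_u_zero : ‖b‖ • (gkb A b 0).u = b := gkbStep_sigma_smul A b 0

theorem toEuclideanLin_gkb_v (k : ℕ) : Matrix.toEuclideanLin A (gkb A b k).v =
    gkbRho A b k • (gkb A b k).u + gkbSigma A b (k + 1) • (gkb A b (k + 1)).u := by
  have h := gkbStep_sigma_smul A
    (Matrix.toEuclideanLin A (gkb A b k).v - (gkb A b k).rho • (gkb A b k).u) (gkb A b k).v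
  change gkbSigma A b (k + 1) • (gkb A b (k + 1)).u = _ at h
  rw [h, gkbRho]
  abel

theorem toEuclideanLin_transpose_gkb_u_zero :
    Matrix.toEuclideanLin Aᵀ (gkb A b 0).u = gkbRho A b 0 • (gkb A b 0).v := by
  have h := gkbStep_rho_smul A b 0
  rw [smul_zero, sub_zero] at h
  exact h.symm

theorem toEuclideanLin_transpose_gkb_u_succ (k : ℕ) :
    Matrix.toEuclideanLin Aᵀ (gkb A b (k + 1)).u =
      gkbRho A b (k + 1) • (gkb A b (k + 1)).v + gkbSigma A b (k + 1) • (gkb A b k).v := by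
  have h := gkbStep_rho_smul A
    (Matrix.toEuclideanLin A (gkb A b k).v - (gkb A b k).rho • (gkb A b k).u) (gkb A b k).v
  change gkbRho A b (k + 1) • (gkb A b (k + 1)).v =
    Matrix.toEuclideanLin Aᵀ (gkb A b (k + 1)).u - gkbSigma A b (k + 1) • (gkb A b k).v at h
  rw [h]
  abel

theorem gkbRho_eq_zero_of_sigma (k : ℕ) (h : gkbSigma A b k = 0) : gkbRho A b k = 0 := by
  have hu := (gkb_u_eq_zero_iff A b k).2 h
  rw [← gkb_v_eq_zero_iff]
  by_contra hv
  have hρ := mt (gkb_v_eq_zero_iff A b k).2 hv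
  cases k with
  | zero =>
    have := toEuclideanLin_transpose_gkb_u_zero A b
    rw [hu, map_zero] at this
    exact (smul_ne_zero hρ hv) this.symm
  | succ k =>
    have := toEuclideanLin_transpose_gkb_u_succ A b k
    rw [hu, map_zero, h, zero_smul, add_zero] at this
    exact (smul_ne_zero hρ hv) this.symm

theorem gkbSigma_succ_eq_zero_of_rho (k : ℕ) (h : gkbRho A b k = 0) :
    gkbSigma A b (k + 1) = 0 := by
  have := toEuclideanLin_gkb_v A b k
  rw [(gkb_v_eq_zero_iff A b k).2 h, map_zero, h, zero_smul, zero_add] at this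
  by_contra hσ
  exact (smul_ne_zero hσ (mt (gkb_u_eq_zero_iff A b _).1 hσ)) this.symm

/-- Once the process has terminated, it stays at zero. -/
theorem gkbSigma_eq_zero_of_le {k l : ℕ} (hkl : k ≤ l) (h : gkbSigma A b k = 0) :
    gkbSigma A b l = 0 := by
  induction l, hkl using Nat.le_induction with
  | base => exact h
  | succ l _ ih => exact gkbSigma_succ_eq_zero_of_rho A b l (gkbRho_eq_zero_of_sigma A b l ih)

/-- Orthogonality of the vectors `u_i`, and of the vectors `v_i`, by a joint induction; the vectors
past termination are zero. -/
theorem gkb_orthogonal_lt (k : ℕ) : ∀ i < k,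
    inner ℝ (gkb A b i).u (gkb A b k).u = 0 ∧ inner ℝ (gkb A b i).v (gkb A b k).v = 0 := by
  induction k with
  | zero => intro i hi; omega
  | succ k ih =>
    -- A zero vector is orthogonal to everything, so only nonzero coefficients matter.
    by_cases hσ : gkbSigma A b (k + 1) = 0
    · intro i _
      rw [(gkb_u_eq_zero_iff A b _).2 hσ,
        (gkb_v_eq_zero_iff A b _).2 (gkbRho_eq_zero_of_sigma A b _ hσ)]
      simp
    have hρk : gkbRho A b k ≠ 0 := mt (gkbSigma_succ_eq_zero_of_rho A b k) hσ
    have hσk : gkbSigma A b k ≠ 0 := mt (gkbRho_eq_zero_of_sigma A b k) hρk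
    have nu := norm_gkb_u A b k hσk
    have nv := norm_gkb_v A b k hρk
    have nu' := norm_gkb_u A b _ hσ
    have huu : ∀ i < k + 1, inner ℝ (gkb A b i).u (gkb A b (k + 1)).u = 0 := by
      intro i hi
      have h1 : inner ℝ (gkb A b i).u (Matrix.toEuclideanLin A (gkb A b k).v) =
          inner ℝ (Matrix.toEuclideanLin Aᵀ (gkb A b i).u) (gkb A b k).v := by
        have := inner_toEuclideanLin Aᵀ (gkb A b i).u (gkb A b k).v
        rw [Matrix.transpose_transpose] at this
        exact this.symm
      rw [toEuclideanLin_gkb_v, inner_add_right, inner_smul_right, inner_smul_right] at h1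
      have h2 : inner ℝ (Matrix.toEuclideanLin Aᵀ (gkb A b i).u) (gkb A b k).v =
          gkbRho A b k * inner ℝ (gkb A b i).u (gkb A b k).u := by
        rcases Nat.lt_succ_iff_lt_or_eq.1 hi with hlt | rfl
        · rw [(ih i hlt).1, mul_zero]
          cases i with
          | zero =>
            rw [toEuclideanLin_transpose_gkb_u_zero, inner_smul_left, (ih 0 hlt).2, mul_zero]
          | succ i =>
            rw [toEuclideanLin_transpose_gkb_u_succ, inner_add_left, inner_smul_left,
              inner_smul_left, (ih _ hlt).2, (ih i (by omega)).2]
            simp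
        · rw [real_inner_self_eq_norm_sq, nu]
          cases i with
          | zero =>
            rw [toEuclideanLin_transpose_gkb_u_zero, inner_smul_left, real_inner_self_eq_norm_sq,
              nv]
            simp
          | succ i =>
            rw [toEuclideanLin_transpose_gkb_u_succ, inner_add_left, inner_smul_left,
              inner_smul_left, real_inner_self_eq_norm_sq, nv, (ih i (by omega)).2]
            simp
      rw [h2] at h1
      have h3 : gkbSigma A b (k + 1) * inner ℝ (gkb A b i).u (gkb A b (k + 1)).u = 0 := by
        linarith
      exact (mul_eq_zero.1 h3).resolve_left hσ
    intro i hi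
    refine ⟨huu i hi, ?_⟩
    by_cases hρ : gkbRho A b (k + 1) = 0
    · rw [(gkb_v_eq_zero_iff A b _).2 hρ, inner_zero_right]
    have h1 := inner_toEuclideanLin A (gkb A b i).v (gkb A b (k + 1)).u
    rw [toEuclideanLin_gkb_v, toEuclideanLin_transpose_gkb_u_succ, inner_add_left,
      inner_smul_left, inner_smul_left, inner_add_right, inner_smul_right, inner_smul_right,
      huu i hi] at h1
    have h2 : gkbSigma A b (i + 1) * inner ℝ (gkb A b (i + 1)).u (gkb A b (k + 1)).u =
        gkbSigma A b (k + 1) * inner ℝ (gkb A b i).v (gkb A b k).v := by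
      rcases Nat.lt_succ_iff_lt_or_eq.1 hi with hlt | rfl
      · rw [huu _ (by omega), (ih i hlt).2, mul_zero, mul_zero]
      · rw [real_inner_self_eq_norm_sq, real_inner_self_eq_norm_sq, nu', nv]
    simp only [conj_trivial, mul_zero, zero_add] at h1
    have h3 : gkbRho A b (k + 1) * inner ℝ (gkb A b i).v (gkb A b (k + 1)).v = 0 := by
      linarith
    exact (mul_eq_zero.1 h3).resolve_left hρ

theorem gkb_u_orthogonal {i j : ℕ} (h : i ≠ j) :
    inner ℝ (gkb A b i).u (gkb A b j).u = 0 := by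
  rcases lt_or_gt_of_ne h with h | h
  · exact (gkb_orthogonal_lt A b j i h).1
  · rw [real_inner_comm]
    exact (gkb_orthogonal_lt A b i j h).1

/-- The process terminates: there are no `m + 1` orthonormal vectors in dimension `m`. -/
theorem gkbSigma_eq_zero {k : ℕ} (hk : m ≤ k) : gkbSigma A b k = 0 := by
  refine gkbSigma_eq_zero_of_le A b hk ?_
  by_contra hm
  have hne : ∀ i : Fin (m + 1), gkbSigma A b i ≠ 0 := fun i h =>
    hm (gkbSigma_eq_zero_of_le A b (by omega) h)
  have hon : Orthonormal ℝ fun i : Fin (m + 1) => (gkb A b i).u :=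
    ⟨fun i => norm_gkb_u A b i (hne i), fun i j hij =>
      gkb_u_orthogonal A b (fun h => hij (Fin.ext h))⟩
  have := hon.linearIndependent.fintype_card_le_finrank
  simp at this

theorem norm_sq_sum_smul_gkb_u (k : ℕ) (s : ℕ → ℝ) (hs : ∀ i, gkbSigma A b i = 0 → s i = 0) :
    ‖∑ i ∈ Finset.range k, s i • (gkb A b i).u‖ ^ 2 = ∑ i ∈ Finset.range k, s i ^ 2 := by
  rw [← real_inner_self_eq_norm_sq, sum_inner]
  refine Finset.sum_congr rfl fun i hi => ?_
  rw [inner_sum, Finset.sum_eq_single i]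
  · rw [inner_smul_left, inner_smul_right, real_inner_self_eq_norm_sq]
    by_cases h : gkbSigma A b i = 0
    · simp [hs i h]
    · rw [norm_gkb_u A b i h]
      simp [pow_two]
  · intro j _ hji
    rw [inner_smul_left, inner_smul_right, gkb_u_orthogonal A b hji.symm]
    simp
  · exact fun h => absurd hi h

theorem toEuclideanLin_transpose_sum (K : ℕ) (s : ℕ → ℝ) :
    Matrix.toEuclideanLin Aᵀ (∑ i ∈ Finset.range (K + 1), s i • (gkb A b i).u) =
      (∑ j ∈ Finset.range (K + 1),
        upperBidiag (gkbRho A b) (gkbSigma A b) s j • (gkb A b j).v) -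
      (gkbSigma A b (K + 1) * s (K + 1)) • (gkb A b K).v := by
  induction K with
  | zero =>
    simp only [zero_add, Finset.sum_range_one, map_smul, toEuclideanLin_transpose_gkb_u_zero,
      upperBidiag]
    module
  | succ K ih =>
    rw [Finset.sum_range_succ, map_add, ih, Finset.sum_range_succ _ (K + 1), map_smul,
      toEuclideanLin_transpose_gkb_u_succ]
    simp only [upperBidiag]
    module

theorem toEuclideanLin_sum (K : ℕ) (t : ℕ → ℝ) :
    Matrix.toEuclideanLin A (∑ j ∈ Finset.range (K + 1), t j • (gkb A b j).v) =
      (∑ i ∈ Finset.range (K + 1),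
        lowerBidiag (gkbRho A b) (gkbSigma A b) t i • (gkb A b i).u) +
      (gkbSigma A b (K + 1) * t K) • (gkb A b (K + 1)).u := by
  induction K with
  | zero =>
    simp only [zero_add, Finset.sum_range_one, map_smul, toEuclideanLin_gkb_v, lowerBidiag]
    module
  | succ K ih =>
    rw [Finset.sum_range_succ, map_add, ih, Finset.sum_range_succ _ (K + 1), map_smul,
      toEuclideanLin_gkb_v]
    simp only [lowerBidiag]
    module

/-- After `m` steps the Krylov space of `b` is exhausted, so the quadrature is exact. -/
theorem gaussBound_eq_discrepancyFun (hb : b ≠ 0) (ε : ℝ) {k : ℕ} (hk1 : 1 ≤ k) (hk : m ≤ k)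
    {β : ℝ} (hβ : 0 ≤ β) : gaussBound A b ε k β = discrepancyFun A b ε β := by
  obtain ⟨K, rfl⟩ : ∃ K, k = K + 1 := ⟨k - 1, by omega⟩
  set s := tridiagSol (gkbRho A b) (gkbSigma A b) β (K + 1) with hs
  set x := ∑ i ∈ Finset.range (K + 1), s i • (gkb A b i).u with hx
  have hσ : gkbSigma A b (K + 1) = 0 := gkbSigma_eq_zero A b hk
  have hAA : Matrix.toEuclideanLin A (Matrix.toEuclideanLin Aᵀ x) =
      ∑ i ∈ Finset.range (K + 1), lowerBidiag (gkbRho A b) (gkbSigma A b)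
        (upperBidiag (gkbRho A b) (gkbSigma A b) s) i • (gkb A b i).u := by
    rw [hx, toEuclideanLin_transpose_sum, hσ, zero_mul, zero_smul, sub_zero, toEuclideanLin_sum,
      hσ, zero_mul, zero_smul, add_zero]
  have hsol : β • Matrix.toEuclideanLin A (Matrix.toEuclideanLin Aᵀ (‖b‖ • x)) + ‖b‖ • x = b := by
    rw [map_smul, map_smul, hAA, smul_comm β, ← smul_add, hx, Finset.smul_sum,
      ← Finset.sum_add_distrib, Finset.sum_eq_single 0]
    · have := tridiagSol_spec (ρ := gkbRho A b) (σ := gkbSigma A b) hβ hk1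
      rw [if_pos rfl] at this
      rw [smul_smul, ← add_smul, add_comm, hs, this, one_smul, norm_smul_gkb_u_zero]
    · intro i hi h0
      have := tridiagSol_spec (ρ := gkbRho A b) (σ := gkbSigma A b) hβ (Finset.mem_range.1 hi)
      rw [if_neg h0] at this
      rw [smul_smul, ← add_smul, add_comm, hs, this, zero_smul]
    · intro h
      simp at h
  have hmat : (β • (A * Aᵀ) + 1) *ᵥ (‖b‖ • x).ofLp = b.ofLp := by
    rw [Matrix.add_mulVec, Matrix.smul_mulVec, Matrix.one_mulVec, ← Matrix.mulVec_mulVec]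
    exact congrArg WithLp.ofLp hsol
  have hM := posDef_smul_add_one (posSemidef_self_mul_transpose A) hβ
  have hzero : ∀ i, gkbSigma A b i = 0 → s i = 0 := by
    intro i hi
    cases i with
    | zero => exact absurd (norm_eq_zero.1 hi) hb
    | succ i =>
      rw [hs, tridiagSol, backwardAbs_eq_zero
        (fun j hj => gkbSigma_eq_zero_of_le A b (show i + 1 ≤ j + 1 by omega) hi) _
        (Nat.lt_succ_self i), mul_zero]
  rw [discrepancyFun, dotProduct_inv_sq_mulVec hM hmat, ← inner_eq_ofLp_dotProduct,
    real_inner_self_eq_norm_sq, norm_smul, norm_norm, mul_pow, hx,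
    norm_sq_sum_smul_gkb_u A b _ s hzero, gaussBound_eq_sum A b ε _ hβ]
  congr 2
  exact Finset.sum_congr rfl fun i _ => by rw [hs, tridiagSol_sq]

/-- Without breakdown and for `m ≤ n`, solving `A v_k = ρ_k u_k + σ_{k+1} u_{k+1}` for `u_k`
backwards from the last step shows that `b` lies in the range of `A`. -/
theorem exists_toEuclideanLin_eq_of_noBreakdown (hA : GKBNoBreakdown A b) (hmn : m ≤ n) :
    ∃ x, Matrix.toEuclideanLin A x = b := by
  have key : ∀ j i, m ≤ i + j → (gkb A b i).u ∈ LinearMap.range (Matrix.toEuclideanLin A) := by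
    intro j
    induction j with
    | zero =>
      intro i hi
      rw [(gkb_u_eq_zero_iff A b i).2 (gkbSigma_eq_zero A b (by omega))]
      exact Submodule.zero_mem _
    | succ j ih =>
      intro i hi
      by_cases him : m ≤ i
      · exact ih i (by omega)
      have hρ : gkbRho A b i ≠ 0 := (hA i (by omega)).1.ne'
      have hu : (gkb A b i).u = (gkbRho A b i)⁻¹ • (Matrix.toEuclideanLin A (gkb A b i).v -
          gkbSigma A b (i + 1) • (gkb A b (i + 1)).u) := by
        rw [toEuclideanLin_gkb_v, add_sub_cancel_right, inv_smul_smul₀ hρ]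
      rw [hu]
      exact Submodule.smul_mem _ _ (Submodule.sub_mem _ (LinearMap.mem_range_self _ _)
        (Submodule.smul_mem _ _ (ih (i + 1) (by omega))))
  have := Submodule.smul_mem _ ‖b‖ (key m 0 (by omega))
  rw [norm_smul_gkb_u_zero] at this
  exact this

/-- If `b` has distance less than `ε` to the range of `A`, the discrepancy function is eventually
negative: its limit is the squared norm of the component of `b` in the kernel of `Aᵀ`, minus `ε²`,
and `b` may be replaced by `b - A x` there. -/
theorem exists_discrepancyFun_neg {ε : ℝ} {x : EuclideanSpace ℝ (Fin n)}
    (hx : ‖b - Matrix.toEuclideanLin A x‖ < ε) : ∃ β, 0 < β ∧ discrepancyFun A b ε β < 0 := by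
  have hS := posSemidef_self_mul_transpose A
  have hH := hS.isHermitian
  set e := b - Matrix.toEuclideanLin A x with he
  have hlim := tendsto_dampedSum_atTop (a := eigenWeight hH b.ofLp) hS.eigenvalues_nonneg
  have hker : ∀ i, hH.eigenvalues i = 0 → eigenWeight hH b.ofLp i = eigenWeight hH e.ofLp i := by
    intro i hi
    have h0 : Aᵀ *ᵥ (hH.eigenvectorBasis i).ofLp = 0 := by
      have h1 := hH.mulVec_eigenvectorBasis i
      rw [hi, zero_smul, ← Matrix.mulVec_mulVec] at h1
      rw [← dotProduct_self_eq_zero]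
      nth_rewrite 1 [Matrix.mulVec_transpose]
      rw [← Matrix.dotProduct_mulVec, h1, dotProduct_zero]
    have h2 : (hH.eigenvectorBasis i).ofLp ⬝ᵥ (A *ᵥ x.ofLp) = 0 := by
      rw [Matrix.dotProduct_mulVec, ← Matrix.mulVec_transpose, h0, zero_dotProduct]
    have h3 : b.ofLp = e.ofLp + A *ᵥ x.ofLp := by
      rw [he]
      simp [Matrix.ofLp_toLpLin]
    unfold eigenWeight
    rw [h3, dotProduct_add, h2, add_zero]
  have hlt : (∑ i, if hH.eigenvalues i = 0 then eigenWeight hH b.ofLp i else 0) < ε ^ 2 := by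
    calc (∑ i, if hH.eigenvalues i = 0 then eigenWeight hH b.ofLp i else 0)
        ≤ ∑ i, eigenWeight hH e.ofLp i := by
          refine Finset.sum_le_sum fun i _ => ?_
          split_ifs with h
          · exact (hker i h).le
          · exact eigenWeight_nonneg hH _ i
      _ = ‖e‖ ^ 2 := by
          rw [← dotProduct_self_eq_sum_eigenWeight, ← inner_eq_ofLp_dotProduct,
            real_inner_self_eq_norm_sq]
      _ < ε ^ 2 := pow_lt_pow_left₀ hx (norm_nonneg _) two_ne_zero
  obtain ⟨β, h1, h2⟩ := ((hlim.eventually (gt_mem_nhds hlt)).and (eventually_gt_atTop 0)).exists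
  refine ⟨β, h2, ?_⟩
  rw [discrepancyFun, dotProduct_resolvent_sq_eq_dampedSum hS _ h2.le]
  linarith

end GolubKahan

/-! ### Convergence of the Newton iteration -/

theorem corollary1 {m n : ℕ} (A : Matrix (Fin m) (Fin n) ℝ) (b : EuclideanSpace ℝ (Fin m))
    (ε : ℝ) (hε : 0 < ε) (hεb : ε < ‖b‖)
    (hA : GKBNoBreakdown A b)
    (hnoise : n < m → ∃ x : EuclideanSpace ℝ (Fin n), ‖b - Matrix.toEuclideanLin A x‖ < ε)
    (β : ℕ → ℝ) (hβ : 0 < β 1) (hG : 0 ≤ gaussBound A b ε 1 (β 1))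
    (hrec : ∀ k : ℕ, 1 ≤ k →
      β (k + 1) = β k - gaussBound A b ε k (β k) / deriv (gaussBound A b ε k) (β k)) :
    (∀ k : ℕ, 1 ≤ k → 0 < β k ∧ DifferentiableAt ℝ (gaussBound A b ε k) (β k) ∧
      deriv (gaussBound A b ε k) (β k) ≠ 0) ∧
    ∃ βstar : ℝ, 0 < βstar ∧ discrepancyFun A b ε βstar = 0 ∧
      (∀ x : ℝ, 0 < x → discrepancyFun A b ε x = 0 → x = βstar) ∧
      (∀ k : ℕ, 1 ≤ k → β k ≤ β (k + 1)) ∧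
      (∀ k : ℕ, 1 ≤ k → β k ≤ βstar) ∧
      Tendsto β atTop (𝓝 βstar) := by
  have hbpos : 0 < ‖b‖ := hε.trans hεb
  have hb : b ≠ 0 := norm_pos_iff.1 hbpos
  have hm : 0 < m := by
    rcases Nat.eq_zero_or_pos m with rfl | h
    · exact absurd (Subsingleton.elim b 0) hb
    · exact h
  have hn : 0 < n := by
    rcases Nat.eq_zero_or_pos n with rfl | h
    · obtain ⟨x, hx⟩ := hnoise hm
      rw [Subsingleton.elim x 0, map_zero, sub_zero] at hx
      exact absurd hx hεb.not_gt
    · exact h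
  have hρ0 : gkbRho A b 0 ≠ 0 := (hA 0 (lt_min hm hn)).1.ne'
  obtain ⟨x, hx⟩ : ∃ x : EuclideanSpace ℝ (Fin n), ‖b - Matrix.toEuclideanLin A x‖ < ε := by
    rcases lt_or_ge n m with h | h
    · exact hnoise h
    · obtain ⟨x, hx⟩ := exists_toEuclideanLin_eq_of_noBreakdown A b hA h
      exact ⟨x, by rwa [hx, sub_self, norm_zero]⟩
  have hS : ∀ k, (gkbMatrix A b k * (gkbMatrix A b k)ᵀ).PosSemidef := fun k =>
    posSemidef_self_mul_transpose _
  set a : ∀ k, Fin k → ℝ := fun k => eigenWeight (hS k).isHermitian (firstBasisVec k) with ha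
  set lam : ∀ k, Fin k → ℝ := fun k => (hS k).isHermitian.eigenvalues with hlam
  have ha0 : ∀ k i, 0 ≤ a k i := fun k => eigenWeight_nonneg _ _
  have hl0 : ∀ k i, 0 ≤ lam k i := fun k => (hS k).eigenvalues_nonneg
  have hform : ∀ k y, 0 ≤ y →
      gaussBound A b ε k y = ‖b‖ ^ 2 * dampedSum (a k) (lam k) y - ε ^ 2 := by
    intro k y hy
    rw [gaussBound, dotProduct_resolvent_sq_eq_dampedSum (hS k) _ hy]
  refine newton_monotone_family (K := m) (f := discrepancyFun A b ε)
    (G' := fun k y => ‖b‖ ^ 2 * dampedSumDeriv (a k) (lam k) y)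
    ?_ ?_ ?_ ?_ ?_ hm ?_ (exists_discrepancyFun_neg A b hx) hβ hG hrec
  · intro k _ y hy
    refine (((hasDerivAt_dampedSum (hl0 k) hy.le).const_mul (‖b‖ ^ 2)).sub_const
      (ε ^ 2)).congr_of_eventuallyEq ?_
    filter_upwards [lt_mem_nhds hy] with z hz using hform k z hz.le
  · intro k hk y hy
    exact mul_neg_of_pos_of_neg (by positivity) (dampedSumDeriv_neg (ha0 k) (hl0 k)
      (exists_eigenWeight_mul_ne_zero _
        (gkbMatrix_mul_transpose_mulVec_ne_zero A b hk hρ0)) hy.le)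
  · intro k _ y z hy hz
    rw [hform k y hy.le, hform k z hz.le]
    have := mul_le_mul_of_nonneg_left (dampedSum_tangent_le (ha0 k) (hl0 k) hy.le hz.le)
      (sq_nonneg ‖b‖)
    linarith
  · exact fun k _ => (continuousOn_dampedSumDeriv (hl0 k)).const_mul _
  · exact fun k _ y hy =>
      gaussBound_le_succ A b (gkbRho_nonneg A b) (gkbSigma_nonneg A b) ε k hy.le
  · exact fun k hk y hy => gaussBound_eq_discrepancyFun A b hb ε (hm.trans_le hk) hk hy.le
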